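/- There is a universal constant $\alpha$ with $0<\alpha\le 1$ such that the following holds. Let $G=(V,E)$ be a finite undirected graph without loops (parallel edges are allowed), let $\Delta\ge 1$ be an integer, and suppose that every vertex of $G$ has degree at most $\Delta$, where parallel edges are counted with multiplicity. Then there is a partition $V=A\cup B$, $A\cap B=\emptyset$ (with $A$ and $B$ both non-empty if $|V|\ge 2$), such that $$\mathrm{tw}(G[A])\ \ge\ \left\lfloor\frac{\alpha\,\mathrm{tw}(G)}{\Delta^2}\right\rfloor\quad\text{and}\quad \mathrm{tw}(G[B])\ \ge\ \left\lfloor\frac{\alpha\,\mathrm{tw}(G)}{\Delta^2}\right\rfloor .$$ Here $G[X]$ is the subgraph of $G$ induced by $X$, and $\mathrm{tw}$ denotes treewidth: the least integer $w\ge 0$ such that the graph has a tree decomposition all of whose bags have at most $w+1$ vertices (so the graph without vertices has treewidth $0$). -/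

import Mathlib

/-!
Suppose that in every partition of the vertex set one side has treewidth at most `t`, and put
`s = (t + 1) * Δ`. Among the partitions whose two sides have treewidth `O(s)`, take one with fewest
crossing edges; its side `A` of smaller treewidth has treewidth at most `t`. If the whole graph has
treewidth much larger than `s * Δ`, there are many crossing edges, because deleting one end of each
of them reduces the treewidth to that of the two sides.

A tree decomposition has a bag whose removal cuts the side `B` other than `A` into `B₁` and `B₂`,
each receiving a constant fraction of the crossing edges, with few edges between them. If `B₁` has
treewidth above `t`, then `B₁` and its complement form a partition with fewer crossing edges; if
`A ∪ B₁` has treewidth at most `t`, then `A ∪ B₁` and `B₂` do. Otherwise, cut `A` in the same way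
into pieces with boundary `O(s)` and few edges between them, and add the pieces one after another
to `B₁`, in an order that keeps the number of crossing edges small. Consider the piece whose
addition raises the treewidth above `t`: as its boundary is `O(s)` the treewidth is then `O(s)`,
while the other side has treewidth at most `t`. The resulting partition again has fewer crossing
edges, a contradiction.
-/

namespace Graph

/-- The degree of a vertex of a multigraph: parallel edges are counted with multiplicity and
loops twice. -/
noncomputable def eDegree {V E : Type*} (G : Graph V E) (v : V) : ℕ∞ :=
  (G.incidenceSet v).encard + (G.loopSet v).encard

/-- A tree decomposition of `G` whose tree has node set `ι`. -/
structure TreeDecomposition {V E : Type*} (G : Graph V E) (ι : Type*) where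
  /-- The decomposition tree. -/
  tree : SimpleGraph ι
  isTree : tree.IsTree
  /-- The bags, finite sets of vertices of `G`. -/
  bag : ι → Finset V
  bag_subset : ∀ i, ∀ v ∈ bag i, v ∈ G.vertexSet
  exists_mem_bag : ∀ v ∈ G.vertexSet, ∃ i, v ∈ bag i
  exists_adj_mem_bag : ∀ u v, G.Adj u v → ∃ i, u ∈ bag i ∧ v ∈ bag i
  /-- The nodes whose bags contain a given vertex span a subtree. -/
  connected_bags : ∀ v ∈ G.vertexSet, (tree.induce {i | v ∈ bag i}).Connected

/-- The treewidth of a finite graph: the least `w` such that `G` has a tree decomposition, over a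
finite tree, whose bags all have at most `w + 1` vertices. The graph without vertices gets
treewidth `0`. -/
noncomputable def treewidth {V E : Type*} (G : Graph V E) : ℕ :=
  sInf {w : ℕ | ∃ (n : ℕ) (D : G.TreeDecomposition (Fin n)), ∀ i, (D.bag i).card ≤ w + 1}

end Graph

namespace TreewidthPartition

open Finset
open scoped Graph

section Trees

variable {ι κ : Type*} {T : SimpleGraph ι} {T' : SimpleGraph κ}

lemma connected_induce_image {s : Set ι} (hs : (T.induce s).Connected) (f : T →g T') :
    (T'.induce (f '' s)).Connected :=
  hs.map (SimpleGraph.induceHom f (Set.mapsTo_image f s)) (Set.surjective_mapsTo_image_restrict f s)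

lemma isTree_sum_sup_edge [Finite ι] [Finite κ] (hT : T.IsTree) (hT' : T'.IsTree)
    (i : ι) (j : κ) : ((T ⊕g T') ⊔ SimpleGraph.edge (.inl i) (.inr j)).IsTree := by
  have hconn := SimpleGraph.Connected.sum_sup_edge (v := i) (w := j) hT.connected hT'.connected
  rw [SimpleGraph.isTree_iff_connected_and_card] at hT hT' ⊢
  refine ⟨hconn, ?_⟩
  have hnew : s(Sum.inl i, Sum.inr j) ∉ (T ⊕g T').edgeSet := by simp
  have hedges : ((T ⊕g T') ⊔ SimpleGraph.edge (.inl i) (.inr j)).edgeSet =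
      insert s(.inl i, .inr j) (T ⊕g T').edgeSet := by
    rw [SimpleGraph.edgeSet_sup, SimpleGraph.edgeSet_edge_of_ne Sum.inl_ne_inr, Set.union_comm,
      Set.singleton_union]
  rw [hedges, Nat.card_coe_set_eq, Set.ncard_insert_of_notMem hnew (Set.toFinite _),
    ← Nat.card_coe_set_eq, Nat.card_congr SimpleGraph.edgeSetSumEquiv, Nat.card_sum, Nat.card_sum]
  omega

end Trees

section Treewidth

variable {V E ι : Type*} {G H : Graph V E} {w : ℕ}

lemma treewidth_le_of_treeDecomposition [Finite ι] (D : G.TreeDecomposition ι)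
    (hD : ∀ i, #(D.bag i) ≤ w + 1) : G.treewidth ≤ w := by
  obtain ⟨n, ⟨e⟩⟩ := Finite.exists_equiv_fin ι
  let φ : D.tree ≃g D.tree.map e.toEmbedding := SimpleGraph.Iso.map e D.tree
  refine Nat.sInf_le ⟨n, {
    tree := D.tree.map e.toEmbedding
    isTree := φ.isTree_iff.1 D.isTree
    bag i := D.bag (e.symm i)
    bag_subset i := D.bag_subset _
    exists_mem_bag v hv := e.symm.surjective.exists.1 (D.exists_mem_bag v hv)
    exists_adj_mem_bag u v huv := e.symm.surjective.exists.1 (D.exists_adj_mem_bag u v huv)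
    connected_bags v hv := ?_ }, fun i => hD _⟩
  rw [show {i | v ∈ D.bag (e.symm i)} = φ.toHom '' {i | v ∈ D.bag i} from
    (e.image_eq_preimage_symm {i | v ∈ D.bag i}).symm]
  exact connected_induce_image (D.connected_bags v hv) φ.toHom

/-- The tree decomposition of a finite graph with a single bag, giving the trivial bound on the
treewidth. -/
noncomputable def singleBagDecomposition (hG : V(G).Finite) : G.TreeDecomposition (Fin 1) where
  tree := ⊥
  isTree := .of_subsingleton
  bag _ := hG.toFinset
  bag_subset _ _ hv := hG.mem_toFinset.1 hv
  exists_mem_bag _ hv := ⟨0, hG.mem_toFinset.2 hv⟩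
  exists_adj_mem_bag _ _ huv := ⟨0, hG.mem_toFinset.2 huv.left_mem, hG.mem_toFinset.2 huv.right_mem⟩
  connected_bags v hv := by
    have : Nonempty {_i : Fin 1 | v ∈ hG.toFinset} := ⟨0, hG.mem_toFinset.2 hv⟩
    exact SimpleGraph.IsTree.of_subsingleton.connected

lemma exists_treeDecomposition_card_bag_le (hG : V(G).Finite) :
    ∃ (n : ℕ) (D : G.TreeDecomposition (Fin n)), ∀ i, #(D.bag i) ≤ G.treewidth + 1 :=
  Nat.sInf_mem (s := {w | ∃ (n : ℕ) (D : G.TreeDecomposition (Fin n)), ∀ i, #(D.bag i) ≤ w + 1})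
    ⟨#hG.toFinset, 1, singleBagDecomposition hG, fun _ => Nat.le_succ _⟩

lemma treewidth_mono (hHG : H ≤ G) (hG : V(G).Finite) : H.treewidth ≤ G.treewidth := by
  classical
  obtain ⟨n, D, hD⟩ := exists_treeDecomposition_card_bag_le hG
  have hmem {v : V} (hv : v ∈ V(H)) (i : Fin n) : v ∈ (D.bag i).filter (· ∈ V(H)) ↔ v ∈ D.bag i :=
    by simp [hv]
  exact treewidth_le_of_treeDecomposition {
    tree := D.tree
    isTree := D.isTree
    bag i := (D.bag i).filter (· ∈ V(H))
    bag_subset i v hv := (mem_filter.1 hv).2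
    exists_mem_bag v hv := by
      simpa only [hmem hv] using D.exists_mem_bag v (hHG.vertexSet_mono hv)
    exists_adj_mem_bag u v huv := by
      simpa only [hmem huv.left_mem, hmem huv.right_mem] using
        D.exists_adj_mem_bag u v (huv.mono hHG)
    connected_bags v hv := by
      rw [show {i | v ∈ (D.bag i).filter (· ∈ V(H))} = {i | v ∈ D.bag i} from Set.ext (hmem hv)]
      exact D.connected_bags v (hHG.vertexSet_mono hv) }
    fun i => (card_filter_le _ _).trans (hD i)

lemma adj_induce_iff {X : Set V} {u v : V} :
    (G.induce X).Adj u v ↔ G.Adj u v ∧ u ∈ X ∧ v ∈ X := by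
  simp [Graph.Adj]

lemma adj_deleteVerts_iff {X : Set V} {u v : V} :
    (G.deleteVerts X).Adj u v ↔ G.Adj u v ∧ u ∉ X ∧ v ∉ X := by
  simp [Graph.Adj]

lemma treewidth_le_treewidth_deleteVerts_add_card (hG : V(G).Finite) (C : Finset V) :
    G.treewidth ≤ (G.deleteVerts C).treewidth + #C := by
  classical
  obtain ⟨n, D, hD⟩ := exists_treeDecomposition_card_bag_le (G := G.deleteVerts C)
    (by simpa only [Graph.vertexSet_deleteVerts] using hG.sdiff)
  have : Nonempty (Fin n) := D.isTree.connected.nonempty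
  let bag (i : Fin n) : Finset V := D.bag i ∪ C.filter (· ∈ V(G))
  have hbag_of_mem {v : V} (hvC : v ∈ C) (hv : v ∈ V(G)) (i : Fin n) : v ∈ bag i :=
    mem_union_right _ (mem_filter.2 ⟨hvC, hv⟩)
  have hbag_of_notMem {v : V} (hvC : v ∉ C) (i : Fin n) : v ∈ bag i ↔ v ∈ D.bag i := by
    simp [bag, hvC]
  have hexists (v : V) (hv : v ∈ V(G)) : ∃ i, v ∈ bag i := by
    by_cases hvC : v ∈ C
    · exact ⟨Classical.arbitrary _, hbag_of_mem hvC hv _⟩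
    · simpa only [hbag_of_notMem hvC] using D.exists_mem_bag v (by simpa using ⟨hv, hvC⟩)
  exact treewidth_le_of_treeDecomposition {
    tree := D.tree
    isTree := D.isTree
    bag := bag
    bag_subset i v hv := by
      rcases mem_union.1 hv with hv | hv
      · have := D.bag_subset i v hv
        exact (show v ∈ V(G) \ C by simpa using this).1
      · exact (mem_filter.1 hv).2
    exists_mem_bag := hexists
    exists_adj_mem_bag u v huv := by
      by_cases huC : u ∈ C
      · exact (hexists v huv.right_mem).imp fun i hi => ⟨hbag_of_mem huC huv.left_mem i, hi⟩
      by_cases hvC : v ∈ C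
      · exact (hexists u huv.left_mem).imp fun i hi => ⟨hi, hbag_of_mem hvC huv.right_mem i⟩
      simpa only [hbag_of_notMem huC, hbag_of_notMem hvC] using
        D.exists_adj_mem_bag u v (adj_deleteVerts_iff.2 ⟨huv, huC, hvC⟩)
    connected_bags v hv := by
      by_cases hvC : v ∈ C
      · rw [show {i | v ∈ bag i} = Set.univ from Set.eq_univ_of_forall (hbag_of_mem hvC hv)]
        exact (SimpleGraph.induceUnivIso D.tree).connected_iff.2 D.isTree.connected
      · rw [show {i | v ∈ bag i} = {i | v ∈ D.bag i} from Set.ext (hbag_of_notMem hvC)]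
        exact D.connected_bags v (by simpa using ⟨hv, hvC⟩) }
    fun i => (card_union_le _ _).trans <| by
      rw [add_right_comm]
      exact Nat.add_le_add (hD i) (card_filter_le _ _)

end Treewidth

section InducedTreewidth

variable {V E ι κ : Type*} {G : Graph V E} {X Y C : Finset V}

/-- The treewidth of the subgraph of `G` induced by a finite set of vertices. -/
noncomputable def inducedTreewidth (G : Graph V E) (X : Finset V) : ℕ :=
  (G.induce X).treewidth

lemma inducedTreewidth_empty : inducedTreewidth G ∅ = 0 := by
  have hfin : V(G.induce (∅ : Finset V)).Finite := finite_toSet ∅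
  exact Nat.le_zero.1 <| treewidth_le_of_treeDecomposition (singleBagDecomposition hfin)
    (by simp [singleBagDecomposition])

lemma inducedTreewidth_mono (hXY : X ⊆ Y) : inducedTreewidth G X ≤ inducedTreewidth G Y :=
  treewidth_mono ⟨coe_subset.2 hXY, fun _ _ _ h => ⟨h.1, hXY h.2.1, hXY h.2.2⟩⟩
    Y.finite_toSet

variable [DecidableEq V]

lemma inducedTreewidth_le_inducedTreewidth_sdiff_add_card :
    inducedTreewidth G X ≤ inducedTreewidth G (X \ C) + #C := by
  have hdelete : (G.induce X).deleteVerts C = G.induce ↑(X \ C) := by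
    refine Graph.ext (by simp) fun e u v => ?_
    simp only [Graph.deleteVerts_isLink, Graph.induce_isLink, coe_sdiff, Set.mem_sdiff]
    tauto
  unfold inducedTreewidth
  rw [← hdelete]
  exact treewidth_le_treewidth_deleteVerts_add_card X.finite_toSet C

/-- The tree decomposition of `G[X ∪ Y]` obtained from decompositions of `G[X]` and `G[Y]` by adding
an edge between the nodes `i` and `j` of their trees, when no edge of `G` runs between the disjoint
sets `X` and `Y`. -/
def joinDecomposition [Finite ι] [Finite κ] (D : (G.induce X).TreeDecomposition ι)
    (D' : (G.induce Y).TreeDecomposition κ) (i : ι) (j : κ) (hXY : Disjoint X Y)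
    (hadj : ∀ u ∈ X, ∀ v ∈ Y, ¬ G.Adj u v) :
    (G.induce ↑(X ∪ Y)).TreeDecomposition (ι ⊕ κ) where
  tree := (D.tree ⊕g D'.tree) ⊔ SimpleGraph.edge (.inl i) (.inr j)
  isTree := isTree_sum_sup_edge D.isTree D'.isTree i j
  bag := Sum.elim D.bag D'.bag
  bag_subset := by
    rintro (a | a) v hv
    · exact mem_union_left _ (D.bag_subset a v hv)
    · exact mem_union_right _ (D'.bag_subset a v hv)
  exists_mem_bag v hv := by
    rcases mem_union.1 hv with hv | hv
    · exact Sum.exists.2 (.inl (D.exists_mem_bag v hv))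
    · exact Sum.exists.2 (.inr (D'.exists_mem_bag v hv))
  exists_adj_mem_bag u v huv := by
    obtain ⟨huv, hu, hv⟩ := adj_induce_iff.1 huv
    rcases mem_union.1 hu with hu | hu <;> rcases mem_union.1 hv with hv | hv
    · exact Sum.exists.2 (.inl (D.exists_adj_mem_bag u v (adj_induce_iff.2 ⟨huv, hu, hv⟩)))
    · exact (hadj u hu v hv huv).elim
    · exact (hadj v hv u hu huv.symm).elim
    · exact Sum.exists.2 (.inr (D'.exists_adj_mem_bag u v (adj_induce_iff.2 ⟨huv, hu, hv⟩)))
  connected_bags v hv := by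
    rcases mem_union.1 hv with hv | hv
    · have hbag : {a | v ∈ Sum.elim D.bag D'.bag a} = Sum.inl '' {a | v ∈ D.bag a} := by
        ext (a | a)
        · simp
        · simpa using fun ha => disjoint_left.1 hXY hv (D'.bag_subset a v ha)
      rw [hbag]
      exact connected_induce_image (D.connected_bags v hv)
        ((SimpleGraph.Hom.ofLE le_sup_left).comp SimpleGraph.Embedding.sumInl.toHom)
    · have hbag : {a | v ∈ Sum.elim D.bag D'.bag a} = Sum.inr '' {a | v ∈ D'.bag a} := by
        ext (a | a)
        · simpa using fun ha => disjoint_right.1 hXY hv (D.bag_subset a v ha)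
        · simp
      rw [hbag]
      exact connected_induce_image (D'.connected_bags v hv)
        ((SimpleGraph.Hom.ofLE le_sup_left).comp SimpleGraph.Embedding.sumInr.toHom)

lemma inducedTreewidth_union_le_max (hXY : Disjoint X Y)
    (hadj : ∀ u ∈ X, ∀ v ∈ Y, ¬ G.Adj u v) :
    inducedTreewidth G (X ∪ Y) ≤ max (inducedTreewidth G X) (inducedTreewidth G Y) := by
  obtain ⟨m, D, hD⟩ := exists_treeDecomposition_card_bag_le (G := G.induce X) X.finite_toSet
  obtain ⟨n, D', hD'⟩ := exists_treeDecomposition_card_bag_le (G := G.induce Y) Y.finite_toSet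
  obtain ⟨i⟩ := D.isTree.connected.nonempty
  obtain ⟨j⟩ := D'.isTree.connected.nonempty
  refine treewidth_le_of_treeDecomposition (joinDecomposition D D' i j hXY hadj) ?_
  rintro (a | a)
  · exact (hD a).trans (Nat.succ_le_succ (le_max_left _ _))
  · exact (hD' a).trans (Nat.succ_le_succ (le_max_right _ _))

end InducedTreewidth

section Cut

variable {V E : Type*} {G : Graph V E} {A B P U X Y Z : Finset V}

open scoped Classical in
/-- The number of pairs `(u, v) ∈ X × Y` of adjacent vertices, that is, the number of edges between
disjoint sets `X` and `Y`, parallel edges being counted once. -/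
noncomputable def cut (G : Graph V E) (X Y : Finset V) : ℕ :=
  #(Rel.interedges G.Adj X Y)

lemma cut_comm : cut G X Y = cut G Y X := by
  classical
  exact Rel.card_interedges_comm X Y

lemma cut_empty_left : cut G ∅ X = 0 := by
  simp [cut]

lemma cut_empty_right : cut G X ∅ = 0 := by
  rw [cut_comm, cut_empty_left]

lemma cut_mono (hAX : A ⊆ X) (hBY : B ⊆ Y) : cut G A B ≤ cut G X Y := by
  classical
  exact card_le_card (Rel.interedges_mono hAX hBY)

lemma cut_biUnion_left [DecidableEq V] {ι : Type*} {I : Finset ι} {f : ι → Finset V}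
    (hf : (I : Set ι).PairwiseDisjoint f) :
    cut G (I.biUnion f) Y = ∑ i ∈ I, cut G (f i) Y := by
  classical
  unfold cut
  rw [Rel.interedges_biUnion_left, card_biUnion]
  exact fun i hi j hj hij => Rel.interedges_disjoint_left _ (hf hi hj hij) Y

lemma cut_eq_sum_singleton : cut G X Y = ∑ v ∈ X, cut G {v} Y := by
  classical
  rw [← cut_biUnion_left (f := singleton) fun _ _ _ _ h => disjoint_singleton.2 h,
    biUnion_singleton_eq_self]

lemma cut_le_card_mul {Δ : ℕ} (h : ∀ v ∈ X, cut G {v} Y ≤ Δ) : cut G X Y ≤ #X * Δ := by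
  rw [cut_eq_sum_singleton]
  exact sum_le_card_nsmul X _ Δ h

variable [DecidableEq V]

lemma cut_union_left (hXY : Disjoint X Y) : cut G (X ∪ Y) Z = cut G X Z + cut G Y Z := by
  rw [cut_eq_sum_singleton, sum_union hXY, ← cut_eq_sum_singleton, ← cut_eq_sum_singleton]

lemma cut_add_cut_sdiff (hYX : Y ⊆ X) : cut G Y Z + cut G (X \ Y) Z = cut G X Z := by
  rw [← cut_union_left disjoint_sdiff, union_sdiff_of_subset hYX]

lemma cut_union_right (hXY : Disjoint X Y) : cut G Z (X ∪ Y) = cut G Z X + cut G Z Y := by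
  rw [cut_comm, cut_union_left hXY, cut_comm (X := X), cut_comm (X := Y)]

lemma cut_sdiff_eq_add (hYP : Y ⊆ P) (hPU : P ⊆ U) :
    cut G Y (U \ Y) = cut G Y (U \ P) + cut G Y (P \ Y) := by
  rw [← cut_union_right (disjoint_sdiff_self_left.mono_right sdiff_subset)]
  congr 1
  grind

lemma cut_union_sdiff_union (hYZ : Disjoint Y Z) (hAY : A ⊆ Y) (hBZ : B ⊆ Z) :
    cut G (A ∪ B) ((Y ∪ Z) \ (A ∪ B)) =
      cut G A (Y \ A) + cut G B (Z \ B) + (cut G A (Z \ B) + cut G (Y \ A) B) := by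
  have hcompl : (Y ∪ Z) \ (A ∪ B) = (Y \ A) ∪ (Z \ B) := by
    have := disjoint_left.1 hYZ
    grind
  rw [hcompl, cut_union_left (hYZ.mono hAY hBZ),
    cut_union_right (hYZ.mono sdiff_subset sdiff_subset),
    cut_union_right (hYZ.mono sdiff_subset sdiff_subset), cut_comm (X := B) (Y := Y \ A)]
  ring

lemma inducedTreewidth_union_le_max_add_cut (hXY : Disjoint X Y) :
    inducedTreewidth G (X ∪ Y) ≤
      max (inducedTreewidth G X) (inducedTreewidth G Y) + cut G X Y := by
  classical
  set C := (Rel.interedges G.Adj X Y).image Prod.fst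
  have hnadj : ∀ u ∈ X \ C, ∀ v ∈ Y \ C, ¬ G.Adj u v := by
    intro u hu v hv huv
    obtain ⟨huX, huC⟩ := mem_sdiff.1 hu
    exact huC (mem_image_of_mem Prod.fst
      (Rel.mk_mem_interedges_iff.2 ⟨huX, (mem_sdiff.1 hv).1, huv⟩))
  calc inducedTreewidth G (X ∪ Y) ≤ inducedTreewidth G ((X ∪ Y) \ C) + #C :=
        inducedTreewidth_le_inducedTreewidth_sdiff_add_card
    _ ≤ max (inducedTreewidth G (X \ C)) (inducedTreewidth G (Y \ C)) + cut G X Y := by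
        rw [union_sdiff_distrib]
        exact Nat.add_le_add (inducedTreewidth_union_le_max
          (hXY.mono sdiff_subset sdiff_subset) hnadj) card_image_le
    _ ≤ _ := by gcongr <;> exact inducedTreewidth_mono sdiff_subset

end Cut

section BalancedCut

variable {ι V E : Type*} {T : SimpleGraph ι} {i : ι} {S : Finset ι}

/-- `S` is a union of connected components of `T - i`. -/
def IsBranch (T : SimpleGraph ι) (i : ι) (S : Finset ι) : Prop :=
  i ∉ S ∧ ∀ x ∈ S, ∀ y, T.Adj x y → y ∈ S ∨ y = i

namespace IsBranch

lemma subset_of_connected (hS : IsBranch T i S) {N : Set ι} (hN : (T.induce N).Connected)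
    (hi : i ∉ N) {x : ι} (hxN : x ∈ N) (hxS : x ∈ S) : N ⊆ S := by
  intro y hyN
  by_contra hyS
  obtain ⟨p⟩ := hN.preconnected ⟨x, hxN⟩ ⟨y, hyN⟩
  obtain ⟨d, -, hd₁, hd₂⟩ := p.exists_boundary_dart (Subtype.val ⁻¹' S) hxS hyS
  rcases hS.2 _ hd₁ _ d.adj with h | h
  · exact hd₂ h
  · exact hi (h ▸ d.snd.2)

lemma exists_adj (hS : IsBranch T i S) (hT : T.Connected) (hne : S.Nonempty) :
    ∃ j ∈ S, T.Adj i j := by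
  obtain ⟨x, hx⟩ := hne
  obtain ⟨p⟩ := hT.preconnected x i
  obtain ⟨d, -, hd₁, hd₂⟩ := p.exists_boundary_dart S hx hS.1
  have hdi : d.snd = i := (hS.2 _ hd₁ _ d.adj).resolve_left hd₂
  exact ⟨d.fst, hd₁, hdi ▸ d.adj.symm⟩

lemma exists_split [DecidableEq ι] (hS : IsBranch T i S) (hT : T.IsTree) (hne : S.Nonempty) :
    ∃ j S₁ S₂, IsBranch T j S₁ ∧ IsBranch T i S₂ ∧ S₁ ⊂ S ∧ S₂ ⊂ S ∧
      S = insert j (S₁ ∪ S₂) := by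
  classical
  obtain ⟨j, hj, hij⟩ := hS.exists_adj hT.connected hne
  let D := T.deleteEdges {s(i, j)}
  have hbridge : ¬ D.Reachable j i := fun h => SimpleGraph.isBridge_iff.1
    (SimpleGraph.isAcyclic_iff_forall_adj_isBridge.1 hT.isAcyclic hij) h.symm
  have hstep {x y : ι} (hx : D.Reachable j x) (hxy : T.Adj x y) :
      D.Reachable j y ∨ x = j ∧ y = i := by
    by_cases hedge : s(x, y) = s(i, j)
    · rcases Sym2.eq_iff.1 hedge with ⟨rfl, -⟩ | h
      exacts [(hbridge hx).elim, .inr h]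
    · exact .inl (hx.trans (SimpleGraph.deleteEdges_adj.2 ⟨hxy, hedge⟩).reachable)
  refine ⟨j, {x ∈ S | D.Reachable j x ∧ x ≠ j}, {x ∈ S | ¬ D.Reachable j x}, ⟨by simp, ?_⟩,
    ⟨by simp [hS.1], ?_⟩, ?_, ?_, ?_⟩
  · intro x hx y hxy
    obtain ⟨hxS, hjx, hxj⟩ := mem_filter.1 hx
    have hjy : D.Reachable j y := (hstep hjx hxy).resolve_right fun h => hxj h.1
    have hyS : y ∈ S := (hS.2 x hxS y hxy).resolve_right fun h => hbridge (h ▸ hjy)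
    simp only [mem_filter]
    tauto
  · intro x hx y hxy
    obtain ⟨hxS, hjx⟩ := mem_filter.1 hx
    refine (hS.2 x hxS y hxy).imp_left fun hyS => mem_filter.2 ⟨hyS, fun hjy => ?_⟩
    rcases hstep hjy hxy.symm with h | ⟨-, rfl⟩
    exacts [hjx h, hS.1 hxS]
  · exact filter_ssubset.2 ⟨j, hj, by simp⟩
  · exact filter_ssubset.2 ⟨j, hj, by simp⟩
  · ext x
    have := SimpleGraph.Reachable.refl (G := D) j
    grind

end IsBranch

variable [DecidableEq V] {G : Graph V E} {X : Finset V}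

/-- The vertices that occur in a bag of a node in `S` but not in the bag of `i`. When `S` is a
branch at `i`, the bag of `i` separates them from the other vertices. -/
def branchVertices (D : G.TreeDecomposition ι) (i : ι) (S : Finset ι) : Finset V :=
  S.biUnion D.bag \ D.bag i

lemma mem_branchVertices {D : G.TreeDecomposition ι} {v : V} :
    v ∈ branchVertices D i S ↔ (∃ x ∈ S, v ∈ D.bag x) ∧ v ∉ D.bag i := by
  simp [branchVertices]

lemma mem_bag_of_adj_branchVertices {D : G.TreeDecomposition ι} (hS : IsBranch D.tree i S)
    {u v : V} (hu : u ∈ branchVertices D i S) (hv : v ∉ branchVertices D i S)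
    (huv : G.Adj u v) : v ∈ D.bag i := by
  obtain ⟨⟨x, hxS, hux⟩, hui⟩ := mem_branchVertices.1 hu
  obtain ⟨z, huz, hvz⟩ := D.exists_adj_mem_bag u v huv
  have hzS : z ∈ S := hS.subset_of_connected (D.connected_bags u huv.left_mem) hui hux hxS huz
  by_contra hvi
  exact hv (mem_branchVertices.2 ⟨⟨z, hzS, hvz⟩, hvi⟩)

lemma branchVertices_insert_union_subset [DecidableEq ι] {D : G.TreeDecomposition ι} {j : ι}
    {S₁ S₂ : Finset ι} : branchVertices D i (insert j (S₁ ∪ S₂)) ⊆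
      branchVertices D j S₁ ∪ branchVertices D i S₂ ∪ D.bag j := by
  intro v
  simp only [mem_union, mem_branchVertices, mem_insert]
  grind

lemma mem_branchVertices_erase_union_bag [Fintype ι] [DecidableEq ι]
    {D : G.TreeDecomposition ι} {v : V} (hv : v ∈ V(G)) :
    v ∈ branchVertices D i (univ.erase i) ∪ D.bag i := by
  obtain ⟨x, hx⟩ := D.exists_mem_bag v hv
  simp only [mem_union, mem_branchVertices, mem_erase, mem_univ]
  grind

lemma sum_union_le_add (μ : V → ℕ) (X Y : Finset V) :
    ∑ v ∈ X ∪ Y, μ v ≤ ∑ v ∈ X, μ v + ∑ v ∈ Y, μ v := by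
  rw [← sum_union_inter]
  exact Nat.le_add_right _ _

lemma exists_isBranch_balanced (D : G.TreeDecomposition ι) {μ : V → ℕ} {β W : ℕ}
    (hβ : ∀ j, ∑ v ∈ D.bag j, μ v ≤ β) (hS : IsBranch D.tree i S)
    (hlarge : W < 3 * ∑ v ∈ branchVertices D i S, μ v) :
    ∃ j S', IsBranch D.tree j S' ∧ W < 3 * ∑ v ∈ branchVertices D j S', μ v ∧
      3 * ∑ v ∈ branchVertices D j S', μ v ≤ 2 * W + 3 * β := by
  classical
  induction S using Finset.strongInduction generalizing i with
  | H S ih =>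
  by_cases hbal : 3 * ∑ v ∈ branchVertices D i S, μ v ≤ 2 * W + 3 * β
  · exact ⟨i, S, hS, hlarge, hbal⟩
  have hne : S.Nonempty := by
    rw [nonempty_iff_ne_empty]
    rintro rfl
    simp [branchVertices] at hlarge
  obtain ⟨j, S₁, S₂, hj₁, hi₂, hS₁, hS₂, rfl⟩ := hS.exists_split D.isTree hne
  by_cases hlarge₁ : W < 3 * ∑ v ∈ branchVertices D j S₁, μ v
  · exact ih S₁ hS₁ hj₁ hlarge₁
  refine ih S₂ hS₂ hi₂ ?_
  have hsplit := (sum_le_sum_of_subset (f := μ)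
    (branchVertices_insert_union_subset (D := D) (i := i) (j := j) (S₁ := S₁) (S₂ := S₂))).trans
    ((sum_union_le_add μ _ _).trans (Nat.add_le_add_right (sum_union_le_add μ _ _) _))
  have := hβ j
  omega

lemma cut_branchVertices_le {D : (G.induce X).TreeDecomposition ι} (hS : IsBranch D.tree i S)
    {Δ : ℕ} (hdeg : ∀ v ∈ X, cut G {v} X ≤ Δ) :
    cut G (branchVertices D i S) (X \ branchVertices D i S) ≤ #(D.bag i) * Δ := by
  classical
  calc cut G (branchVertices D i S) (X \ branchVertices D i S)
      ≤ cut G X (D.bag i) := by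
        refine card_le_card fun ⟨u, v⟩ huv => ?_
        obtain ⟨hu, hv, hadj⟩ := Rel.mk_mem_interedges_iff.1 huv
        obtain ⟨hvX, hvS⟩ := mem_sdiff.1 hv
        obtain ⟨⟨x, -, hux⟩, -⟩ := mem_branchVertices.1 hu
        have huX : u ∈ X := D.bag_subset x u hux
        exact Rel.mk_mem_interedges_iff.2 ⟨huX,
          mem_bag_of_adj_branchVertices hS hu hvS (adj_induce_iff.2 ⟨hadj, huX, hvX⟩), hadj⟩
    _ = cut G (D.bag i) X := cut_comm
    _ ≤ #(D.bag i) * Δ := cut_le_card_mul fun v hv => hdeg v (D.bag_subset i v hv)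

lemma exists_balanced_cut {Δ β : ℕ} (hβ : (inducedTreewidth G X + 1) * Δ ≤ β)
    (hdeg : ∀ v ∈ X, cut G {v} X ≤ Δ) {μ : V → ℕ} (hμ : ∀ v ∈ X, μ v ≤ Δ)
    (hμX : 3 * β < 2 * ∑ v ∈ X, μ v) :
    ∃ Y ⊆ X, cut G Y (X \ Y) ≤ β ∧ ∑ v ∈ X, μ v < 3 * ∑ v ∈ Y, μ v ∧
      3 * ∑ v ∈ Y, μ v ≤ 2 * ∑ v ∈ X, μ v + 3 * β := by
  obtain ⟨n, D, hD⟩ := exists_treeDecomposition_card_bag_le (G := G.induce X) X.finite_toSet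
  have hcard (i : Fin n) : #(D.bag i) * Δ ≤ β := (Nat.mul_le_mul_right Δ (hD i)).trans hβ
  have hbag (i : Fin n) : ∑ v ∈ D.bag i, μ v ≤ β :=
    (sum_le_card_nsmul _ _ Δ fun v hv => hμ v (D.bag_subset i v hv)).trans (hcard i)
  obtain ⟨i⟩ : Nonempty (Fin n) := D.isTree.connected.nonempty
  have hi : IsBranch D.tree i (univ.erase i) := ⟨by simp, fun _ _ y _ => by simp [em']⟩
  have hlarge : ∑ v ∈ X, μ v < 3 * ∑ v ∈ branchVertices D i (univ.erase i), μ v := by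
    have hcover : X ⊆ branchVertices D i (univ.erase i) ∪ D.bag i :=
      fun v hv => mem_branchVertices_erase_union_bag hv
    have := (sum_le_sum_of_subset (f := μ) hcover).trans (sum_union_le_add μ _ _)
    have := hbag i
    omega
  obtain ⟨j, S, hS, hlow, hhigh⟩ := exists_isBranch_balanced D hbag hi hlarge
  refine ⟨branchVertices D j S, fun v hv => ?_, (cut_branchVertices_le hS hdeg).trans (hcard j),
    hlow, hhigh⟩
  obtain ⟨⟨x, -, hvx⟩, -⟩ := mem_branchVertices.1 hv
  exact D.bag_subset x v hvx

end BalancedCut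

section Pieces

variable {V E : Type*} [DecidableEq V] {G : Graph V E} {P U X Y Z : Finset V} {s Δ : ℕ}

lemma exists_balanced_cut_of_lt_cut (hs : (inducedTreewidth G X + 1) * Δ ≤ s)
    (hdeg : ∀ v ∈ X, cut G {v} X ≤ Δ) (hZ : ∀ v ∈ X, cut G {v} Z ≤ Δ)
    (hXZ : 3 * s < 2 * cut G X Z) :
    ∃ Y ⊆ X, cut G Y (X \ Y) ≤ s ∧ cut G X Z < 3 * cut G Y Z ∧
      3 * cut G Y Z ≤ 2 * cut G X Z + 3 * s := by
  rw [cut_eq_sum_singleton] at hXZ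
  obtain ⟨Y, hYX, hcut, hlow, hhigh⟩ := exists_balanced_cut hs hdeg hZ hXZ
  rw [← cut_eq_sum_singleton, ← cut_eq_sum_singleton] at hlow hhigh
  exact ⟨Y, hYX, hcut, hlow, hhigh⟩

lemma mul_cut_biUnion_sdiff_le {𝒜 ℬ 𝒮 : Finset (Finset V)} (hYZ : Disjoint Y Z)
    {k m n : ℕ} (h𝒜 : 𝒜.biUnion id = Y) (hℬ : ℬ.biUnion id = Z)
    (hm : ∀ 𝒮 ⊆ 𝒜, k * cut G (𝒮.biUnion id) (Y \ 𝒮.biUnion id) ≤ m)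
    (hn : ∀ 𝒮 ⊆ ℬ, k * cut G (𝒮.biUnion id) (Z \ 𝒮.biUnion id) ≤ n) (h𝒮 : 𝒮 ⊆ 𝒜 ∪ ℬ) :
    k * cut G (𝒮.biUnion id) ((Y ∪ Z) \ 𝒮.biUnion id) ≤ m + n + k * cut G Y Z := by
  have hm := hm (𝒮 ∩ 𝒜) inter_subset_right
  have hn := hn (𝒮 ∩ ℬ) inter_subset_right
  set A := (𝒮 ∩ 𝒜).biUnion id
  set B := (𝒮 ∩ ℬ).biUnion id
  have hA : A ⊆ Y := h𝒜 ▸ biUnion_subset_biUnion_of_subset_left id inter_subset_right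
  have hB : B ⊆ Z := hℬ ▸ biUnion_subset_biUnion_of_subset_left id inter_subset_right
  have hAB : 𝒮.biUnion id = A ∪ B := by
    rw [← union_biUnion, ← inter_union_distrib_left, inter_eq_left.2 h𝒮]
  have hcross : cut G A (Z \ B) + cut G (Y \ A) B ≤ cut G Y Z := by
    rw [← cut_add_cut_sdiff hA]
    exact Nat.add_le_add (cut_mono subset_rfl sdiff_subset) (cut_mono subset_rfl hB)
  rw [hAB, cut_union_sdiff_union hYZ hA hB, mul_add, mul_add]
  gcongr

-- The last bound survives a split of `P`: the boundaries of the two halves add up to that of `P`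
-- plus twice the at most `s` new crossing pairs, and `2 * s + 16 * s = 18 * s`. Since each half
-- inherits at least `17 * s` of a boundary above `54 * s`, truncated subtraction does no harm.
lemma exists_pieces (hs : (inducedTreewidth G P + 1) * Δ ≤ s) (hPU : P ⊆ U)
    (hdeg : ∀ v ∈ U, cut G {v} U ≤ Δ) :
    ∃ 𝒜 : Finset (Finset V), (𝒜 : Set (Finset V)).PairwiseDisjoint id ∧ 𝒜.biUnion id = P ∧
      (∀ Q ∈ 𝒜, cut G Q (U \ Q) ≤ 54 * s) ∧
      ∀ 𝒮 ⊆ 𝒜, 16 * cut G (𝒮.biUnion id) (P \ 𝒮.biUnion id) ≤ cut G P (U \ P) - 18 * s := by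
  induction hW : cut G P (U \ P) using Nat.strong_induction_on generalizing P with
  | h W ih =>
  subst hW
  by_cases hsmall : cut G P (U \ P) ≤ 54 * s
  · refine ⟨{P}, by simp, by simp, by simpa using hsmall, fun 𝒮 h𝒮 => ?_⟩
    rcases subset_singleton_iff.1 h𝒮 with rfl | rfl <;> simp [cut_empty_left, cut_empty_right]
  have hdegP {Z : Finset V} (hZ : Z ⊆ U) (v : V) (hv : v ∈ P) : cut G {v} Z ≤ Δ :=
    (cut_mono subset_rfl hZ).trans (hdeg v (hPU hv))
  obtain ⟨Y, hYP, hYZ, hlow, hhigh⟩ :=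
    exists_balanced_cut_of_lt_cut hs (hdegP hPU) (hdegP (sdiff_subset (t := P))) (by omega)
  have hsub {X : Finset V} (hX : X ⊆ P) : (inducedTreewidth G X + 1) * Δ ≤ s :=
    le_trans (by gcongr; exact inducedTreewidth_mono hX) hs
  have hboundaryY : cut G Y (U \ Y) = cut G Y (U \ P) + cut G Y (P \ Y) :=
    cut_sdiff_eq_add hYP hPU
  have hboundaryZ : cut G (P \ Y) (U \ (P \ Y)) = cut G (P \ Y) (U \ P) + cut G Y (P \ Y) := by
    rw [cut_sdiff_eq_add sdiff_subset hPU, Finset.sdiff_sdiff_eq_self hYP, cut_comm (X := Y)]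
  have hsum := cut_add_cut_sdiff (G := G) (Z := U \ P) hYP
  obtain ⟨𝒜, h𝒜, hY, hbd, hin⟩ := ih (cut G Y (U \ Y)) (by omega) (hsub hYP) (hYP.trans hPU) rfl
  obtain ⟨ℬ, hℬ, hZ, hbd', hin'⟩ := ih (cut G (P \ Y) (U \ (P \ Y))) (by omega)
    (hsub sdiff_subset) (sdiff_subset.trans hPU) rfl
  refine ⟨𝒜 ∪ ℬ, ?_, ?_, fun Q hQ => (mem_union.1 hQ).elim (hbd Q) (hbd' Q), fun 𝒮 h𝒮 => ?_⟩
  · rw [coe_union, Set.pairwiseDisjoint_union]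
    refine ⟨h𝒜, hℬ, fun Q hQ Q' hQ' _ => ?_⟩
    have hQY : Q ⊆ Y := hY ▸ subset_biUnion_of_mem id hQ
    have hQZ : Q' ⊆ P \ Y := hZ ▸ subset_biUnion_of_mem id hQ'
    exact disjoint_sdiff.mono hQY hQZ
  · rw [union_biUnion, hY, hZ, union_sdiff_of_subset hYP]
  · have := mul_cut_biUnion_sdiff_le disjoint_sdiff hY hZ hin hin' h𝒮
    rw [union_sdiff_of_subset hYP] at this
    omega

end Pieces

section Switching

variable {κ M : Type*} [DecidableEq κ] [AddCommMonoid M] [LinearOrder M] [IsOrderedAddMonoid M]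
  {I S : Finset κ} {x y : κ → M} {h : M}

-- If no insertion decreases the sum, then `x < y` on `I \ S`, and the total `∑ c ∈ I, y c` is
-- an upper bound.
lemma exists_insert_sum_add_sum_sdiff_le (hSI : S ⊂ I) (hS : ∑ c ∈ S, y c + ∑ c ∈ I \ S, x c ≤ h)
    (hy : ∑ c ∈ I, y c ≤ h) :
    ∃ c ∈ I \ S, ∑ a ∈ insert c S, y a + ∑ a ∈ I \ insert c S, x a ≤ h := by
  by_cases hle : ∃ c ∈ I \ S, y c ≤ x c
  · obtain ⟨c, hc, hyx⟩ := hle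
    refine ⟨c, hc, ?_⟩
    calc ∑ a ∈ insert c S, y a + ∑ a ∈ I \ insert c S, x a
        = ∑ a ∈ S, y a + (y c + ∑ a ∈ (I \ S).erase c, x a) := by
          rw [sum_insert (mem_sdiff.1 hc).2, sdiff_insert, add_comm (y c), add_assoc]
      _ ≤ ∑ a ∈ S, y a + (x c + ∑ a ∈ (I \ S).erase c, x a) := by gcongr
      _ = ∑ a ∈ S, y a + ∑ a ∈ I \ S, x a := by rw [add_sum_erase _ _ hc]
      _ ≤ h := hS
  · push Not at hle
    obtain ⟨c, hc⟩ : (I \ S).Nonempty := sdiff_nonempty.2 hSI.2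
    refine ⟨c, hc, ?_⟩
    calc ∑ a ∈ insert c S, y a + ∑ a ∈ I \ insert c S, x a
        ≤ ∑ a ∈ insert c S, y a + ∑ a ∈ I \ insert c S, y a := by
          gcongr with a ha
          exact (hle a (sdiff_subset_sdiff subset_rfl (subset_insert c S) ha)).le
      _ = ∑ a ∈ I, y a := by
          rw [add_comm, sum_sdiff (insert_subset (mem_sdiff.1 hc).1 hSI.1)]
      _ ≤ h := hy

lemma exists_insert_switch (hx : ∑ c ∈ I, x c ≤ h) (hy : ∑ c ∈ I, y c ≤ h)
    {p : Finset κ → Prop} (hp : p ∅) (hpI : ¬ p I) :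
    ∃ S ⊆ I, ∃ c ∈ I \ S, p S ∧ ¬ p (insert c S) ∧
      ∑ a ∈ insert c S, y a + ∑ a ∈ I \ insert c S, x a ≤ h := by
  classical
  obtain ⟨S, hS⟩ := (I.powerset.filter fun S =>
    p S ∧ ∑ a ∈ S, y a + ∑ a ∈ I \ S, x a ≤ h).exists_maximal ⟨∅, by simp [hp, hx]⟩
  simp only [mem_filter, mem_powerset] at hS
  obtain ⟨hSI, hpS, hsum⟩ := hS.prop
  have hne : S ≠ I := by
    rintro rfl
    exact hpI hpS
  obtain ⟨c, hc, hle⟩ := exists_insert_sum_add_sum_sdiff_le (hSI.ssubset_of_ne hne) hsum hy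
  obtain ⟨hcI, hcS⟩ := mem_sdiff.1 hc
  refine ⟨S, hSI, c, hc, hpS, fun hpc => hcS ?_, hle⟩
  exact hS.le_of_ge ⟨insert_subset hcI hSI, hpc, hle⟩ (subset_insert c S) (mem_insert_self c S)

end Switching

section Partition

variable {V E : Type*} [DecidableEq V] {G : Graph V E} {A B U : Finset V} {s t Δ β : ℕ}

lemma biUnion_sdiff_biUnion_of_subset {𝒮 𝒜 : Finset (Finset V)}
    (h𝒜 : (𝒜 : Set (Finset V)).PairwiseDisjoint id) (h𝒮 : 𝒮 ⊆ 𝒜) :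
    𝒜.biUnion id \ 𝒮.biUnion id = (𝒜 \ 𝒮).biUnion id := by
  have hdisj : Disjoint ((𝒜 \ 𝒮).biUnion id) (𝒮.biUnion id) := by
    simp only [disjoint_biUnion_left, disjoint_biUnion_right]
    intro Q hQ Q' hQ'
    exact h𝒜 (mem_sdiff.1 hQ').1 (h𝒮 hQ) (by grind)
  have hunion : 𝒜.biUnion id = (𝒜 \ 𝒮).biUnion id ∪ 𝒮.biUnion id := by
    rw [← union_biUnion, sdiff_union_of_subset h𝒮]
  rw [hunion, union_sdiff_cancel_right hdisj]

lemma exists_switch_piece (hs : (inducedTreewidth G A + 1) * Δ ≤ s) (hAU : A ⊆ U)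
    (hdeg : ∀ v ∈ U, cut G {v} U ≤ Δ) (hB : B ⊆ U \ A) {h : ℕ} (hB₁ : cut G A B ≤ h)
    (hB₂ : cut G A ((U \ A) \ B) ≤ h) {p : Finset V → Prop} (hpB : p B) (hpAB : ¬ p (A ∪ B)) :
    ∃ X Q, p X ∧ ¬ p (Q ∪ X) ∧ Disjoint Q X ∧ Q ⊆ A ∧ Q ∪ X ⊆ U ∧ cut G Q (U \ Q) ≤ 54 * s ∧
      16 * cut G (Q ∪ X) (U \ (Q ∪ X)) ≤
        cut G A (U \ A) - 18 * s + 16 * (cut G B ((U \ A) \ B) + h) := by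
  obtain ⟨𝒜, h𝒜, hA, hbd, hin⟩ := exists_pieces hs hAU hdeg
  have hsum (Z : Finset V) : ∑ Q ∈ 𝒜, cut G Q Z = cut G A Z := by
    rw [← hA, cut_biUnion_left h𝒜]
    rfl
  obtain ⟨𝒮, h𝒮, Q, hQ, hp, hpQ, hle⟩ := exists_insert_switch
    (x := fun Q => cut G Q B) (y := fun Q => cut G Q ((U \ A) \ B))
    ((hsum B).trans_le hB₁) ((hsum _).trans_le hB₂) (p := fun 𝒮 => p (𝒮.biUnion id ∪ B))
    (by simpa using hpB) (by rwa [hA])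
  obtain ⟨hQA, hQ𝒮⟩ := mem_sdiff.1 hQ
  have hQsub : Q ⊆ A := hA ▸ subset_biUnion_of_mem id hQA
  have hinsert : (insert Q 𝒮).biUnion id ∪ B = Q ∪ (𝒮.biUnion id ∪ B) := by
    rw [biUnion_insert, union_assoc, id]
  have hins𝒜 : insert Q 𝒮 ⊆ 𝒜 := insert_subset hQA h𝒮
  have hinsA : (insert Q 𝒮).biUnion id ⊆ A :=
    hA ▸ biUnion_subset_biUnion_of_subset_left id hins𝒜
  have hcross : cut G ((insert Q 𝒮).biUnion id) ((U \ A) \ B) +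
      cut G (A \ (insert Q 𝒮).biUnion id) B ≤ h := by
    rw [← hA, biUnion_sdiff_biUnion_of_subset h𝒜 hins𝒜, cut_biUnion_left (h𝒜.subset hins𝒜),
      cut_biUnion_left (h𝒜.subset sdiff_subset), hA]
    exact hle
  have hcut := cut_union_sdiff_union (G := G) disjoint_sdiff hinsA hB
  rw [union_sdiff_of_subset hAU] at hcut
  refine ⟨𝒮.biUnion id ∪ B, Q, hp, hinsert ▸ hpQ, ?_, hQsub, ?_, hbd Q hQA, ?_⟩
  · refine disjoint_union_right.2 ⟨?_, disjoint_sdiff.mono hQsub hB⟩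
    exact (disjoint_biUnion_right _ _ _).2 fun Q' hQ' => h𝒜 hQA (h𝒮 hQ') (by grind)
  · rw [← hinsert]
    exact union_subset (hinsA.trans hAU) (hB.trans sdiff_subset)
  · rw [← hinsert, hcut]
    have := hin _ hins𝒜
    omega

/-- `U` has no partition into two parts that both induce subgraphs of treewidth more than `t`. -/
def Unsplittable (G : Graph V E) (U : Finset V) (t : ℕ) : Prop :=
  ∀ A ⊆ U, inducedTreewidth G A ≤ t ∨ inducedTreewidth G (U \ A) ≤ t

namespace Unsplittable

lemma exists_partition_treewidth_le (hU : Unsplittable G U t) (ht : t < inducedTreewidth G U) :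
    ∃ A ⊆ U, inducedTreewidth G A ≤ t ∧ inducedTreewidth G (U \ A) ≤ t + 1 := by
  obtain ⟨A, hAU, v, hv, hA, hvA, -⟩ := exists_insert_switch (I := U) (x := 0) (y := 0) (h := 0)
    (by simp) (by simp) (p := fun A => inducedTreewidth G A ≤ t)
    (by simp [inducedTreewidth_empty]) ht.not_ge
  have hrest : inducedTreewidth G (U \ insert v A) ≤ t :=
    (hU _ (insert_subset (mem_sdiff.1 hv).1 hAU)).resolve_left hvA
  refine ⟨A, hAU, hA, inducedTreewidth_le_inducedTreewidth_sdiff_add_card (C := {v}).trans ?_⟩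
  rw [sdiff_sdiff_left, sup_eq_union, union_comm, ← insert_eq, card_singleton]
  exact Nat.succ_le_succ hrest

lemma exists_smaller_cut (hU : Unsplittable G U t) (hdeg : ∀ v ∈ U, cut G {v} U ≤ Δ)
    (hs : (t + 1) * Δ ≤ s) (hβ : (t + 54 * s + 1) * Δ ≤ β) (hsβ : s ≤ β) (hAU : A ⊆ U)
    (hA : inducedTreewidth G A ≤ t) (hB : inducedTreewidth G (U \ A) ≤ t + 54 * s)
    (hcut : 8 * β < cut G A (U \ A)) :
    ∃ A' ⊆ U, inducedTreewidth G A' ≤ t + 54 * s ∧ inducedTreewidth G (U \ A') ≤ t + 54 * s ∧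
      cut G A' (U \ A') < cut G A (U \ A) := by
  have hdegB {Z : Finset V} (hZ : Z ⊆ U) (v : V) (hv : v ∈ U \ A) : cut G {v} Z ≤ Δ :=
    (cut_mono subset_rfl hZ).trans (hdeg v (mem_sdiff.1 hv).1)
  have hcut_comm : cut G (U \ A) A = cut G A (U \ A) := cut_comm
  obtain ⟨B, hBA, hBcut, hlow, hhigh⟩ := exists_balanced_cut_of_lt_cut (s := β)
    (le_trans (by gcongr) hβ) (hdegB sdiff_subset) (hdegB hAU) (by omega)
  have hsum := cut_add_cut_sdiff (G := G) (Z := A) hBA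
  have hBU : B ⊆ U := hBA.trans sdiff_subset
  by_cases hBt : inducedTreewidth G B ≤ t
  swap
  · refine ⟨B, hBU, (inducedTreewidth_mono hBA).trans hB,
      ((hU B hBU).resolve_left hBt).trans (Nat.le_add_right _ _), ?_⟩
    rw [cut_sdiff_eq_add hBA sdiff_subset, Finset.sdiff_sdiff_eq_self hAU]
    omega
  have hABU : A ∪ B ⊆ U := union_subset hAU hBU
  by_cases hABt : inducedTreewidth G (A ∪ B) ≤ t
  · have hcompl : U \ (A ∪ B) = (U \ A) \ B := sdiff_sdiff_left.symm
    refine ⟨A ∪ B, hABU, hABt.trans (Nat.le_add_right _ _), ?_, ?_⟩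
    · rw [hcompl]
      exact (inducedTreewidth_mono sdiff_subset).trans hB
    · rw [hcompl, cut_union_left (disjoint_sdiff.mono_right hBA), cut_comm (X := A)]
      omega
  obtain ⟨X, Q, hX, hQX, hdisj, hQA, hQXU, hQ, hle⟩ := exists_switch_piece
    (h := (2 * cut G A (U \ A) + 3 * β) / 3) (p := fun X => inducedTreewidth G X ≤ t)
    (le_trans (by gcongr) hs) hAU hdeg hBA (by rw [cut_comm]; omega) (by rw [cut_comm]; omega)
    hBt hABt
  refine ⟨Q ∪ X, hQXU, ?_, ((hU _ hQXU).resolve_left hQX).trans (Nat.le_add_right _ _), by omega⟩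
  have hXU : X ⊆ U \ Q := subset_sdiff.2 ⟨subset_union_right.trans hQXU, hdisj.symm⟩
  exact (inducedTreewidth_union_le_max_add_cut hdisj).trans <|
    Nat.add_le_add (max_le ((inducedTreewidth_mono hQA).trans hA) hX)
      ((cut_mono subset_rfl hXU).trans hQ)

lemma exists_smaller_cut_of_treewidth_le (hU : Unsplittable G U t)
    (hdeg : ∀ v ∈ U, cut G {v} U ≤ Δ) (hs : (t + 1) * Δ ≤ s) (hβ : (t + 54 * s + 1) * Δ ≤ β)
    (hsβ : s ≤ β) (hAU : A ⊆ U) (hA : inducedTreewidth G A ≤ t + 54 * s)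
    (hB : inducedTreewidth G (U \ A) ≤ t + 54 * s) (hcut : 8 * β < cut G A (U \ A)) :
    ∃ A' ⊆ U, inducedTreewidth G A' ≤ t + 54 * s ∧ inducedTreewidth G (U \ A') ≤ t + 54 * s ∧
      cut G A' (U \ A') < cut G A (U \ A) := by
  rcases hU A hAU with hAt | hBt
  · exact hU.exists_smaller_cut hdeg hs hβ hsβ hAU hAt hB hcut
  · have hcompl : cut G (U \ A) (U \ (U \ A)) = cut G A (U \ A) := by
      rw [Finset.sdiff_sdiff_eq_self hAU, cut_comm]
    rw [← hcompl] at hcut ⊢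
    exact hU.exists_smaller_cut hdeg hs hβ hsβ sdiff_subset hBt
      (by rwa [Finset.sdiff_sdiff_eq_self hAU]) hcut

lemma inducedTreewidth_lt (hU : Unsplittable G U t) (hΔ : 1 ≤ Δ)
    (hdeg : ∀ v ∈ U, cut G {v} U ≤ Δ) : inducedTreewidth G U < 500 * ((t + 1) * Δ ^ 2) := by
  classical
  by_contra! hlarge
  obtain ⟨s, hs⟩ : ∃ s, s = (t + 1) * Δ := ⟨_, rfl⟩
  have hts : t + 1 ≤ s := hs ▸ Nat.le_mul_of_pos_right _ hΔ
  have hsΔ : s ≤ s * Δ := Nat.le_mul_of_pos_right _ hΔ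
  have hlarge : 500 * (s * Δ) ≤ inducedTreewidth G U := by
    rwa [hs, mul_assoc, ← pow_two]
  let admissible (A : Finset V) : Prop :=
    inducedTreewidth G A ≤ t + 54 * s ∧ inducedTreewidth G (U \ A) ≤ t + 54 * s
  obtain ⟨A₀, hA₀U, hA₀, hA₀'⟩ := hU.exists_partition_treewidth_le (by omega)
  obtain ⟨A, hA, hmin⟩ := (U.powerset.filter admissible).exists_min_image
    (fun A => cut G A (U \ A))
    ⟨A₀, mem_filter.2 ⟨mem_powerset.2 hA₀U, by omega, by omega⟩⟩
  obtain ⟨hAU, hAadm⟩ := mem_filter.1 hA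
  have hAU := mem_powerset.1 hAU
  have hcut : 8 * (55 * (s * Δ)) < cut G A (U \ A) := by
    have := inducedTreewidth_union_le_max_add_cut (G := G) (disjoint_sdiff (s := A) (t := U))
    rw [union_sdiff_of_subset hAU] at this
    have := max_le hAadm.1 hAadm.2
    omega
  have hβ : (t + 54 * s + 1) * Δ ≤ 55 * (s * Δ) := by
    rw [← mul_assoc]
    gcongr
    omega
  obtain ⟨A', hA'U, hA', hA'', hlt⟩ := hU.exists_smaller_cut_of_treewidth_le hdeg hs.ge hβ
    (by omega) hAU hAadm.1 hAadm.2 hcut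
  exact (hmin A' (mem_filter.2 ⟨mem_powerset.2 hA'U, hA', hA''⟩)).not_gt hlt

end Unsplittable

lemma exists_partition_lt_inducedTreewidth (hΔ : 1 ≤ Δ) (hdeg : ∀ v ∈ U, cut G {v} U ≤ Δ)
    (hU : 500 * ((t + 1) * Δ ^ 2) ≤ inducedTreewidth G U) :
    ∃ A ⊆ U, t < inducedTreewidth G A ∧ t < inducedTreewidth G (U \ A) := by
  by_contra! h
  exact hU.not_gt <| Unsplittable.inducedTreewidth_lt
    (fun A hA => or_iff_not_imp_left.2 fun hAt => h A hA (not_le.1 hAt)) hΔ hdeg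

end Partition

section Multigraph

variable {V E : Type*} {G : Graph V E}

lemma encard_setOf_adj_le_eDegree (v : V) : {u | G.Adj v u}.encard ≤ G.eDegree v := by
  have hlink (u : {u | G.Adj v u}) : ∃ e, G.IsLink e v u := u.2
  choose e he using hlink
  have hinj : Function.Injective fun u => (⟨e u, u, he u⟩ : G.incidenceSet v) := fun u u' h =>
    Subtype.ext ((he u).right_unique ((Subtype.mk.inj h) ▸ he u'))
  exact (Function.Embedding.encard_le ⟨_, hinj⟩).trans le_self_add

lemma cut_singleton_le {Δ : ℕ} {v : V} {U : Finset V} (h : {u | G.Adj v u}.encard ≤ Δ) :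
    cut G {v} U ≤ Δ := by
  classical
  have hcut : cut G {v} U = #{u ∈ U | G.Adj v u} := by
    simp [cut, Rel.interedges, singleton_product, filter_map]
  rw [hcut, ← Nat.cast_le (α := ℕ∞), ← Set.encard_coe_eq_coe_finsetCard]
  exact (Set.encard_le_encard fun u hu => (mem_filter.1 hu).2).trans h

lemma nonempty_of_lt_inducedTreewidth {t : ℕ} {X : Finset V} (h : t < inducedTreewidth G X) :
    (X : Set V).Nonempty := by
  rw [coe_nonempty, nonempty_iff_ne_empty]
  rintro rfl
  simp [inducedTreewidth_empty] at h

end Multigraph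

lemma exists_nonempty_partition {V : Type*} (S : Set V) :
    ∃ A B, A ∪ B = S ∧ Disjoint A B ∧ (S.Nontrivial → A.Nonempty ∧ B.Nonempty) := by
  by_cases hS : S.Nontrivial
  · obtain ⟨a, ha, b, hb, hab⟩ := hS
    exact ⟨{a}, S \ {a}, Set.union_sdiff_cancel (Set.singleton_subset_iff.2 ha),
      Set.disjoint_sdiff_right, fun _ => ⟨⟨a, rfl⟩, b, hb, hab.symm⟩⟩
  · exact ⟨S, ∅, Set.union_empty S, Set.disjoint_empty S, fun h => (hS h).elim⟩

lemma mul_sq_le_of_lt_floor_div {w t Δ : ℕ} (hΔ : 1 ≤ Δ)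
    (h : t < ⌊1 / 500 * (w : ℝ) / (Δ : ℝ) ^ 2⌋₊) : 500 * ((t + 1) * Δ ^ 2) ≤ w := by
  have hle := (Nat.le_floor_iff (by positivity)).1 h
  rw [le_div_iff₀ (by positivity)] at hle
  have : (500 * ((t + 1) * Δ ^ 2) : ℝ) ≤ w := by
    push_cast at hle
    linarith
  exact_mod_cast this

end TreewidthPartition

open TreewidthPartition in
theorem theorem4_general {V E : Type*} (G : Graph V E) {Δ : ℕ} (hG : G.vertexSet.Finite)
    (hΔ : 1 ≤ Δ) (hdeg : ∀ v ∈ G.vertexSet, {u | G.Adj v u}.encard ≤ Δ) :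
    ∃ A B : Set V,
      A ∪ B = G.vertexSet ∧ Disjoint A B ∧
      (G.vertexSet.Nontrivial → A.Nonempty ∧ B.Nonempty) ∧
      ⌊1 / 500 * (G.treewidth : ℝ) / (Δ : ℝ) ^ 2⌋₊ ≤ (G.induce A).treewidth ∧
      ⌊1 / 500 * (G.treewidth : ℝ) / (Δ : ℝ) ^ 2⌋₊ ≤ (G.induce B).treewidth := by
  classical
  rcases hfloor : ⌊1 / 500 * (G.treewidth : ℝ) / (Δ : ℝ) ^ 2⌋₊ with _ | t
  · obtain ⟨A, B, hAB, hdisj, hne⟩ := exists_nonempty_partition G.vertexSet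
    exact ⟨A, B, hAB, hdisj, hne, Nat.zero_le _, Nat.zero_le _⟩
  obtain ⟨U, hU⟩ : ∃ U : Finset V, (U : Set V) = G.vertexSet := hG.exists_finset_coe
  have htw : inducedTreewidth G U = G.treewidth := by
    rw [inducedTreewidth, hU, G.induce_vertexSet]
  obtain ⟨A, hAU, hA, hB⟩ := exists_partition_lt_inducedTreewidth hΔ
    (fun v hv => cut_singleton_le (hdeg v (hU ▸ hv)))
    ((mul_sq_le_of_lt_floor_div hΔ hfloor.ge).trans htw.ge)
  refine ⟨A, (U \ A : Finset V), ?_, Finset.disjoint_coe.2 Finset.disjoint_sdiff,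
    fun _ => ⟨nonempty_of_lt_inducedTreewidth hA, nonempty_of_lt_inducedTreewidth hB⟩, hA, hB⟩
  rw [← Finset.coe_union, Finset.union_sdiff_of_subset hAU, hU]

theorem theorem4 :
    ∃ α : ℝ, 0 < α ∧ α ≤ 1 ∧
      ∀ (V : Type*) (E : Type*) (G : Graph V E) (Δ : ℕ),
        G.vertexSet.Finite → G.Loopless → 1 ≤ Δ →
        (∀ v ∈ G.vertexSet, G.eDegree v ≤ Δ) →
        ∃ A B : Set V,
          A ∪ B = G.vertexSet ∧ Disjoint A B ∧
          (G.vertexSet.Nontrivial → A.Nonempty ∧ B.Nonempty) ∧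
          ⌊α * (G.treewidth : ℝ) / (Δ : ℝ) ^ 2⌋₊ ≤ (G.induce A).treewidth ∧
          ⌊α * (G.treewidth : ℝ) / (Δ : ℝ) ^ 2⌋₊ ≤ (G.induce B).treewidth :=
  ⟨1 / 500, by norm_num, by norm_num, fun _ _ G _ hG _ hΔ hdeg => theorem4_general G hG hΔ
    fun v hv => (TreewidthPartition.encard_setOf_adj_le_eDegree v).trans (hdeg v hv)⟩
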